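/- **Theorem 3.** For a finite simple graph $G$, a vertex $w$ and $k\in\mathbb{N}\cup\{\infty\}$, let $G_w^k$ be the subgraph of $G$ induced on the vertices $v$ that are reachable from $w$ and satisfy $d(w,v)\le k$ (for $k=\infty$ it is the connected component of $w$, hence $G$ itself if $G$ is connected), and let $f_w(v)=d(w,v)$ be the shortest-path distance to $w$. Extend $f_w$ to the edges in one of the following two ways. 1. *Lower-star and upper-star:* an edge $uv$ has the value $\max(f_w(u),f_w(v))$ in the ascending and $\min(f_w(u),f_w(v))$ in the descending filtration. 2. *Shifted:* the same if $f_w(u)\ne f_w(v)$, while an edge with $f_w(u)=f_w(v)$ has the value $f_w(u)+\tfrac12$ in the ascending and $f_w(u)-\tfrac12$ in the descending filtration. With $X=G_w^k$, sublevel subgraphs $X_a$ (ascending values $\le a$) and superlevel subgraphs $X^a$ (descending values $\ge a$), let the 1D extended persistence diagram $D_k(G,w)$ be the multiset of (birth, death) points of the degree-one extended persistence module $$0\to\cdots\to H_1(X_a)\to\cdots\to H_1(X)=H_1(X,\emptyset)\to\cdots\to H_1(X,X^a)\to\cdots\to H_1(X,X)=0$$ with coefficients in $\mathbb{Z}/2$,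 where each birth and each death is recorded together with the part (ascending or descending) in which it occurs. Say that *the 1D extended persistence diagram distinguishes* $G$ and $H$ if the multisets $\{\!\{D_k(G,w): w\in V(G)\}\!\}$ and $\{\!\{D_k(H,w): w\in V(H)\}\!\}$ differ. Let 4-WL colour the 4-tuples $\vec v$ of vertices of a graph $G$: the initial colour of $\vec v$ is its isomorphism type (which entries are equal and which are adjacent), and $c^{t+1}_{\vec v}=\bigl(c^{t}_{\vec v},(\{\!\{c^{t}_{\vec v[i\leftarrow x]}: x\in V(G)\}\!\})_{i=1}^{4}\bigr)$, where $\vec v[i\leftarrow x]$ is $\vec v$ with its $i$-th entry replaced by $x$. Say that *4-WL distinguishes* $G$ and $H$ if for some $t$ the multisets of the colours $c^t$ of all 4-tuples of $G$ and of $H$ differ. Then, for each of the two extensions of the filter function and for every $k\in\mathbb{N}\cup\{\infty\}$, the 1D extended persistence diagram is less powerful than 4-WL: any two finite simple graphs that the 1D extended persistence diagram distinguishes are distinguished by 4-WL, and there are two finite simple graphs that 4-WL distinguishes and the 1D extended persistence diagram does not. -/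

import Mathlib

/-! ### The Weisfeiler–Leman test on `k`-tuples of vertices -/

/-- The colours used in round `t` of `k`-WL. The hash function is taken to be the identity, so a
colour of round `0` is an isomorphism type of an ordered `k`-tuple (which entries are equal, which
entries are adjacent), and a colour of round `t + 1` is the previous colour together with `k`
multisets of previous colours. -/
def WLColor (k : ℕ) : ℕ → Type
  | 0 => Fin k → Fin k → Prop × Prop
  | t + 1 => WLColor k t × (Fin k → Multiset (WLColor k t))

/-- The colour of a `k`-tuple after `t` rounds of `k`-WL. In each round the `i`-th multiset collects
the colours of the tuples obtained by replacing the `i`-th entry by each vertex in turn. -/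
def wlColor {V : Type*} [Fintype V] (G : SimpleGraph V) (k : ℕ) :
    (t : ℕ) → (Fin k → V) → WLColor k t
  | 0 => fun v i j => (v i = v j, G.Adj (v i) (v j))
  | t + 1 => fun v =>
      (wlColor G k t v,
        fun i => Finset.univ.val.map fun w : V => wlColor G k t (Function.update v i w))

/-- `k`-WL distinguishes two graphs if the colour histograms differ after some number of rounds. -/
def WLDistinguishes {V W : Type*} [Fintype V] [Fintype W] (k : ℕ)
    (G : SimpleGraph V) (H : SimpleGraph W) : Prop :=
  ∃ t : ℕ,
    (Finset.univ.val.map fun v : Fin k → V => wlColor G k t v) ≠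
      Finset.univ.val.map fun v : Fin k → W => wlColor H k t v

/-! ### Relative homology of pairs of subgraphs, with coefficients in the two-element field

A graph is regarded as a simplicial complex of dimension at most one, and subgraphs are its
subcomplexes. A pair `P = (K, L)` of subgraphs with `L ≤ K` has the relative homology group
`H₁(K, L)`; there are no `2`-chains. -/

namespace GraphHomology

variable {V : Type*} {G : SimpleGraph V}

/-- The `1`-chains of a subgraph, inside the functions on unordered pairs. -/
def chains₁ (K : G.Subgraph) : Submodule (ZMod 2) (Sym2 V → ZMod 2) where
  carrier := {c | ∀ e, e ∉ K.edgeSet → c e = 0}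
  zero_mem' := fun _ _ => rfl
  add_mem' := fun ha hb e he => by simp [ha e he, hb e he]
  smul_mem' := fun r c hc e he => by simp [hc e he]

/-- The `0`-chains of a subgraph, inside the functions on vertices. -/
def chains₀ (K : G.Subgraph) : Submodule (ZMod 2) (V → ZMod 2) where
  carrier := {c | ∀ v, v ∉ K.verts → c v = 0}
  zero_mem' := fun _ _ => rfl
  add_mem' := fun ha hb v hv => by simp [ha v hv, hb v hv]
  smul_mem' := fun r c hc v hv => by simp [hc v hv]

open Classical in
/-- The boundary operator: an edge is sent to the sum of its two endpoints. -/
noncomputable def boundary [Fintype V] (G : SimpleGraph V) :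
    (Sym2 V → ZMod 2) →ₗ[ZMod 2] (V → ZMod 2) :=
  (G.incMatrix (ZMod 2)).mulVecLin

/-- Relative `1`-cycles of `(K, L)`: the `1`-chains of `K` whose boundary lies in `L`. -/
noncomputable def relCycles [Fintype V] (P : G.Subgraph × G.Subgraph) :
    Submodule (ZMod 2) (Sym2 V → ZMod 2) :=
  chains₁ P.1 ⊓ (chains₀ P.2).comap (boundary G)

/-- `H₁(K, L)`: the relative `1`-cycles modulo the `1`-chains of `L`. -/
abbrev H₁ [Fintype V] (P : G.Subgraph × G.Subgraph) : Type _ :=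
  relCycles P ⧸ (chains₁ P.2).submoduleOf (relCycles P)

theorem chains₁_mono {K L : G.Subgraph} (h : K ≤ L) : chains₁ K ≤ chains₁ L :=
  fun _ hc e he => hc e fun he' => he (SimpleGraph.Subgraph.edgeSet_mono h he')

theorem chains₀_mono {K L : G.Subgraph} (h : K ≤ L) : chains₀ K ≤ chains₀ L :=
  fun _ hc v hv => hc v fun hv' => hv (h.1 hv')

theorem relCycles_mono [Fintype V] {P Q : G.Subgraph × G.Subgraph} (h : P ≤ Q) :
    relCycles P ≤ relCycles Q :=
  inf_le_inf (chains₁_mono h.1) (Submodule.comap_mono (chains₀_mono h.2))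

/-- The map `H₁(K, L) → H₁(K', L')` induced by an inclusion of pairs. -/
noncomputable def H₁map [Fintype V] {P Q : G.Subgraph × G.Subgraph} (h : P ≤ Q) :
    H₁ P →ₗ[ZMod 2] H₁ Q :=
  Submodule.mapQ _ _ (Submodule.inclusion (relCycles_mono h))
    fun _ hc => chains₁_mono h.2 hc

/-- The rank of the induced map. -/
noncomputable def rank₁ [Fintype V] {P Q : G.Subgraph × G.Subgraph} (h : P ≤ Q) : ℕ :=
  Module.finrank (ZMod 2) (LinearMap.range (H₁map h))

end GraphHomology

/-! ### Extended persistence of a graph with a filter function -/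

/-- The two ways of extending a filter function from vertices to edges: the lower-star and
upper-star extension, and the variant that moves an edge with equal endpoint values by `1/2`. -/
inductive FiltrationKind
  | star
  | shifted

namespace FiltrationKind

/-- The value of an edge in the ascending filtration, given the values of its endpoints. -/
noncomputable def asc : FiltrationKind → ℝ → ℝ → ℝ
  | star, x, y => max x y
  | shifted, x, y => if x = y then x + 1 / 2 else max x y

/-- The value of an edge in the descending filtration, given the values of its endpoints. -/
noncomputable def desc : FiltrationKind → ℝ → ℝ → ℝ
  | star, x, y => min x y
  | shifted, x, y => if x = y then x - 1 / 2 else min x y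

theorem asc_comm (κ : FiltrationKind) (x y : ℝ) : κ.asc x y = κ.asc y x := by
  cases κ
  · exact max_comm x y
  · by_cases h : x = y
    · simp [asc, h]
    · simp [asc, h, Ne.symm h, max_comm]

theorem desc_comm (κ : FiltrationKind) (x y : ℝ) : κ.desc x y = κ.desc y x := by
  cases κ
  · exact min_comm x y
  · by_cases h : x = y
    · simp [desc, h]
    · simp [desc, h, Ne.symm h, min_comm]

theorem le_asc (κ : FiltrationKind) (x y : ℝ) : x ≤ κ.asc x y := by
  cases κ
  · exact le_max_left x y
  · by_cases h : x = y
    · simp [asc, h]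
    · simp [asc, h]

theorem desc_le (κ : FiltrationKind) (x y : ℝ) : κ.desc x y ≤ x := by
  cases κ
  · exact min_le_left x y
  · by_cases h : x = y
    · simp [desc, h]
    · simp [desc, h]

end FiltrationKind

/-- The parameters of an extended filtration: first the ascending values, then the descending
ones. -/
inductive ExtIndex
  | asc (a : ℝ)
  | desc (a : ℝ)

/-- The order in which the parameters are passed: ascending parameters increase, descending ones
decrease, and all the ascending ones come before all the descending ones. -/
def ExtIndex.Precedes : ExtIndex → ExtIndex → Prop
  | .asc a, .asc b => a < b
  | .asc _, .desc _ => True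
  | .desc _, .asc _ => False
  | .desc a, .desc b => b < a

namespace ExtPersistence

variable {V : Type*} (G : SimpleGraph V) (S : Set V) (f : V → ℝ) (κ : FiltrationKind)

/-- The complex being filtered: the subgraph of `G` induced on `S`. -/
def whole : G.Subgraph := (⊤ : G.Subgraph).induce S

/-- The simplices of the induced subgraph on `S` whose ascending value lies in the lower set `I`. -/
def sublevel (I : LowerSet ℝ) : G.Subgraph where
  verts := {v | v ∈ S ∧ f v ∈ I}
  Adj u v := G.Adj u v ∧ u ∈ S ∧ v ∈ S ∧ κ.asc (f u) (f v) ∈ I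
  adj_sub h := h.1
  edge_vert h := ⟨h.2.1, I.lower (κ.le_asc _ _) h.2.2.2⟩
  symm := ⟨fun _ _ h => ⟨h.1.symm, h.2.2.1, h.2.1, κ.asc_comm _ _ ▸ h.2.2.2⟩⟩

/-- The simplices of the induced subgraph on `S` whose descending value lies in the upper set `I`. -/
def superlevel (I : UpperSet ℝ) : G.Subgraph where
  verts := {v | v ∈ S ∧ f v ∈ I}
  Adj u v := G.Adj u v ∧ u ∈ S ∧ v ∈ S ∧ κ.desc (f u) (f v) ∈ I
  adj_sub h := h.1
  edge_vert h := ⟨h.2.1, I.upper (κ.desc_le _ _) h.2.2.2⟩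
  symm := ⟨fun _ _ h => ⟨h.1.symm, h.2.2.1, h.2.1, κ.desc_comm _ _ ▸ h.2.2.2⟩⟩

/-- The pair at a parameter: `(X_a, ∅)` in the ascending part, `(X, X^a)` in the descending part. -/
def pairAt : ExtIndex → G.Subgraph × G.Subgraph
  | .asc a => (sublevel G S f κ (LowerSet.Iic a), ⊥)
  | .desc a => (whole G S, superlevel G S f κ (UpperSet.Ici a))

/-- The pair immediately before a parameter: `(X_{<a}, ∅)`, respectively `(X, X^{>a})`. -/
def pairBefore : ExtIndex → G.Subgraph × G.Subgraph
  | .asc a => (sublevel G S f κ (LowerSet.Iio a), ⊥)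
  | .desc a => (whole G S, superlevel G S f κ (UpperSet.Ioi a))

theorem sublevel_mono {I J : LowerSet ℝ} (h : ∀ x ∈ I, x ∈ J) :
    sublevel G S f κ I ≤ sublevel G S f κ J :=
  ⟨fun _ hv => ⟨hv.1, h _ hv.2⟩, fun _ _ e => ⟨e.1, e.2.1, e.2.2.1, h _ e.2.2.2⟩⟩

theorem superlevel_mono {I J : UpperSet ℝ} (h : ∀ x ∈ I, x ∈ J) :
    superlevel G S f κ I ≤ superlevel G S f κ J :=
  ⟨fun _ hv => ⟨hv.1, h _ hv.2⟩, fun _ _ e => ⟨e.1, e.2.1, e.2.2.1, h _ e.2.2.2⟩⟩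

theorem sublevel_le_whole (I : LowerSet ℝ) : sublevel G S f κ I ≤ whole G S :=
  ⟨fun _ hv => hv.1, fun _ _ e => ⟨e.2.1, e.2.2.1, e.1⟩⟩

theorem pairBefore_le_pairAt (p : ExtIndex) : pairBefore G S f κ p ≤ pairAt G S f κ p := by
  cases p with
  | asc a => exact ⟨sublevel_mono G S f κ fun x (hx : x < a) => le_of_lt hx, le_rfl⟩
  | desc a => exact ⟨le_rfl, superlevel_mono G S f κ fun x (hx : a < x) => le_of_lt hx⟩

theorem pairAt_le_pairBefore {p q : ExtIndex} (h : p.Precedes q) :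
    pairAt G S f κ p ≤ pairBefore G S f κ q := by
  cases p with
  | asc a =>
    cases q with
    | asc b => exact ⟨sublevel_mono G S f κ fun x (hx : x ≤ a) => lt_of_le_of_lt hx h, le_rfl⟩
    | desc b => exact ⟨sublevel_le_whole G S f κ _, bot_le⟩
  | desc a =>
    cases q with
    | asc b => exact h.elim
    | desc b => exact ⟨le_rfl, superlevel_mono G S f κ fun x (hx : a ≤ x) => lt_of_lt_of_le h hx⟩

open Classical GraphHomology in
/-- The one-dimensional extended persistence diagram of the induced subgraph on `S` with filter
function `f`, as a multiset given by its multiplicities: `diagram₁ p q` is the number of points of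
the degree-one extended persistence module that are born at `p` and die at `q`. The point
`(asc b, desc d)` is the planar point `(b, d)` of a loop that is born in the ascending and killed in
the descending filtration; the other two kinds of points have both coordinates in the ascending or
both in the descending part. -/
noncomputable def diagram₁ [Fintype V] (p q : ExtIndex) : ℤ :=
  if h : p.Precedes q then
    have hp := pairBefore_le_pairAt G S f κ p
    have hq := pairBefore_le_pairAt G S f κ q
    have hpq := pairAt_le_pairBefore G S f κ h
    (rank₁ hpq : ℤ) - rank₁ (hpq.trans hq) - rank₁ (hp.trans hpq)
      + rank₁ ((hp.trans hpq).trans hq)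
  else 0

end ExtPersistence

/-! ### Vicinity graphs, the shortest-path filter, and distinguishing graphs by diagrams -/

/-- The vertices of the `k`-hop neighbourhood of `w`; for `k = ⊤` this is the connected component of
`w`, which is the vertex set of the whole graph when the graph is connected. -/
def vicinity {V : Type*} (G : SimpleGraph V) (k : ℕ∞) (w : V) : Set V :=
  {v | G.Reachable w v ∧ (G.dist w v : ℕ∞) ≤ k}

/-- The one-dimensional extended persistence diagram of the `k`-hop neighbourhood of `w`, filtered
by the shortest-path distance to `w`. -/
noncomputable def distanceDiagram₁ {V : Type*} [Fintype V] (κ : FiltrationKind) (k : ℕ∞)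
    (G : SimpleGraph V) (w : V) : ExtIndex → ExtIndex → ℤ :=
  ExtPersistence.diagram₁ G (vicinity G k w) (fun v => (G.dist w v : ℝ)) κ

/-- The diagrams distinguish two graphs if the multisets of the diagrams of all root vertices
differ. -/
def EPDDistinguishes {V W : Type*} [Fintype V] [Fintype W] (κ : FiltrationKind) (k : ℕ∞)
    (G : SimpleGraph V) (H : SimpleGraph W) : Prop :=
  (Finset.univ.val.map fun w : V => distanceDiagram₁ κ k G w) ≠
    Finset.univ.val.map fun w : W => distanceDiagram₁ κ k H w

/-! ### Bijections that match multisets of values -/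

/-! Every multiplicity in the diagram is a signed sum of four ranks of maps `H₁ P → H₁ Q`. As there
are no 2-chains, such a rank is the dimension of the relative cycles of `P` minus that of the
relative cycles lying in the chains of `Q.2` (`rank₁_add_finrank`). Both spaces have the form
`cyclesRel G K A`, of dimension |E(K)| - |V ∖ A| + #(components of K avoiding A)
(`finrank_cyclesRel`).

These three numbers depend only on the colour of the constant 4-tuple at the root. Entry 0 keeps the
root, entries 1 and 2 hold vertices x and y, and entry 3 is free to trace paths of K from x to y;
filter values are distances to entry 0. In the bijective form of the WL game
(`WLEquiv.exists_equiv`) this matches vertices, edges and component sizes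
(`finrank_cyclesRel_eq_of_match`).

Strictness is witnessed by one edge against two isolated vertices: all diagrams are empty, while the
initial colours already differ. -/

theorem exists_equiv_of_map_univ_eq {α β γ : Type*} [Fintype α] [Fintype β] {f : α → γ}
    {g : β → γ} (h : Finset.univ.val.map f = Finset.univ.val.map g) :
    ∃ σ : α ≃ β, ∀ x, f x = g (σ x) := by
  classical
  have hcard (c : γ) : Fintype.card {x // f x = c} = Fintype.card {y // g y = c} := by
    have := congrArg (Multiset.count c) h
    rw [Multiset.count_map, Multiset.count_map] at this
    rw [Fintype.card_subtype, Fintype.card_subtype]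
    simpa [Finset.card, eq_comm] using this
  let e (c : γ) : {x // f x = c} ≃ {y // g y = c} := Fintype.equivOfCardEq (hcard c)
  refine ⟨(Equiv.sigmaFiberEquiv f).symm.trans
    ((Equiv.sigmaCongrRight e).trans (Equiv.sigmaFiberEquiv g)), fun x => ?_⟩
  exact ((e (f x) ⟨x, rfl⟩).2).symm

theorem map_univ_eq_of_equiv {α β γ : Type*} [Fintype α] [Fintype β] {f : α → γ} {g : β → γ}
    (σ : α ≃ β) (h : ∀ x, f x = g (σ x)) :
    Finset.univ.val.map f = Finset.univ.val.map g := by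
  have hσ : (Finset.univ : Finset α).val.map σ = (Finset.univ : Finset β).val := by
    simp
  rw [← hσ, Multiset.map_map]
  exact Multiset.map_congr rfl fun x _ => h x

/-- A candidate that fails once fails in all later rounds, so if each failed somewhere, none would
survive the largest of the finitely many failure times. This turns one bijection per round into a
single bijection valid in all rounds. -/
theorem Finite.exists_forall_of_antitone {ι : Type*} [Finite ι] {p : ℕ → ι → Prop}
    (hp : ∀ t i, p (t + 1) i → p t i) (h : ∀ t, ∃ i, p t i) : ∃ i, ∀ t, p t i := by
  classical
  have := Fintype.ofFinite ι
  have anti (s d : ℕ) (i : ι) : p (s + d) i → p s i := by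
    induction d with
    | zero => exact id
    | succ d ih => exact fun hi => ih (hp _ _ hi)
  by_contra! hcon
  choose t ht using hcon
  obtain ⟨i, hi⟩ := h (Finset.univ.sup t)
  obtain ⟨d, hd⟩ := Nat.exists_eq_add_of_le (Finset.le_sup (f := t) (Finset.mem_univ i))
  exact ht i (anti _ d i (hd ▸ hi))

/-! ### Tuples that the Weisfeiler–Leman test never separates -/

section WLEquiv

variable {V W : Type*} [Fintype V] [Fintype W] {G : SimpleGraph V} {H : SimpleGraph W}

/-- Two `k`-tuples, possibly of different graphs, that have the same colour in every round. -/
def WLEquiv (G : SimpleGraph V) (H : SimpleGraph W) {k : ℕ} (v : Fin k → V) (v' : Fin k → W) :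
    Prop :=
  ∀ t, wlColor G k t v = wlColor H k t v'

namespace WLEquiv

variable {k : ℕ} {v : Fin k → V} {v' : Fin k → W}

theorem symm (h : WLEquiv G H v v') : WLEquiv H G v' v := fun t => (h t).symm

theorem eq_iff (h : WLEquiv G H v v') (i j : Fin k) : v i = v j ↔ v' i = v' j :=
  Iff.of_eq (congrArg Prod.fst (congrFun (congrFun (h 0) i) j))

theorem adj_iff (h : WLEquiv G H v v') (i j : Fin k) :
    G.Adj (v i) (v j) ↔ H.Adj (v' i) (v' j) :=
  Iff.of_eq (congrArg Prod.snd (congrFun (congrFun (h 0) i) j))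

/-- The move of the bijective pebble game: a bijection of the vertex sets that answers every
replacement of the `i`-th entry. -/
theorem exists_equiv (h : WLEquiv G H v v') (i : Fin k) :
    ∃ σ : V ≃ W, ∀ x, WLEquiv G H (Function.update v i x) (Function.update v' i (σ x)) := by
  obtain ⟨σ, hσ⟩ := Finite.exists_forall_of_antitone
    (p := fun t (σ : V ≃ W) => ∀ x, wlColor G k t (Function.update v i x) =
      wlColor H k t (Function.update v' i (σ x)))
    (fun t σ hσ x => congrArg Prod.fst (hσ x))
    (fun t => exists_equiv_of_map_univ_eq (congrFun (congrArg Prod.snd (h (t + 1))) i))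
  exact ⟨σ, fun x t => hσ t x⟩

end WLEquiv

theorem exists_equiv_of_not_WLDistinguishes {k : ℕ} (h : ¬ WLDistinguishes k G H) :
    ∃ σ : (Fin k → V) ≃ (Fin k → W), ∀ v, WLEquiv G H v (σ v) := by
  classical
  simp only [WLDistinguishes, not_exists, not_not] at h
  obtain ⟨σ, hσ⟩ := Finite.exists_forall_of_antitone
    (p := fun t (σ : (Fin k → V) ≃ (Fin k → W)) => ∀ v, wlColor G k t v = wlColor H k t (σ v))
    (fun t σ hσ x => congrArg Prod.fst (hσ x))
    (fun t => exists_equiv_of_map_univ_eq (h t))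
  exact ⟨σ, fun v t => hσ t v⟩

/-- Since colours record which entries of a tuple are equal, a bijection of tuples that preserves
all colours restricts to the constant tuples. -/
theorem exists_equiv_const_of_not_WLDistinguishes {k : ℕ} [NeZero k]
    (h : ¬ WLDistinguishes k G H) :
    ∃ σ : V ≃ W, ∀ x, WLEquiv G H (fun _ : Fin k => x) (fun _ => σ x) := by
  obtain ⟨τ, hτ⟩ := exists_equiv_of_not_WLDistinguishes h
  have h₁ (x : V) : τ (fun _ => x) = fun _ => τ (fun _ => x) 0 :=
    funext fun i => ((hτ _).eq_iff i 0).1 rfl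
  have h₂ (y : W) : τ.symm (fun _ => y) = fun _ => τ.symm (fun _ => y) 0 :=
    funext fun i => ((hτ (τ.symm fun _ => y)).eq_iff i 0).2 (by simp)
  refine ⟨⟨fun x => τ (fun _ => x) 0, fun y => τ.symm (fun _ => y) 0, fun x => ?_, fun y => ?_⟩,
    fun x => ?_⟩
  · simp [← h₁ x]
  · simp [← h₂ y]
  · simpa [← h₁ x] using hτ fun _ => x

/-! ### Distances and reachability are determined by the colours of `4`-tuples -/

/-- This is where arity four enters: the root and two further entries leave one spare position. -/
theorem exists_fin_four_ne (i j : Fin 4) : ∃ l : Fin 4, l ≠ 0 ∧ l ≠ i ∧ l ≠ j := by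
  revert i j; decide

theorem SimpleGraph.Walk.exists_length_eq_succ_iff {α : Type*} {K : SimpleGraph α} {a b : α}
    {n : ℕ} : (∃ p : K.Walk a b, p.length = n + 1) ↔
      ∃ x, K.Adj a x ∧ ∃ p : K.Walk x b, p.length = n := by
  constructor
  · rintro ⟨p, hp⟩
    cases p with
    | nil => simp at hp
    | cons ha q => exact ⟨_, ha, q, by simpa using hp⟩
  · rintro ⟨x, ha, q, hq⟩
    exact ⟨.cons ha q, by simpa using hq⟩

namespace WLEquiv

variable {v : Fin 4 → V} {v' : Fin 4 → W}

theorem exists_walk_of_length (n : ℕ) (h : WLEquiv G H v v') {i j : Fin 4}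
    (hn : ∃ p : G.Walk (v i) (v j), p.length = n) : ∃ p : H.Walk (v' i) (v' j), p.length = n := by
  induction n generalizing v v' i with
  | zero =>
    rw [SimpleGraph.Walk.exists_length_eq_zero_iff] at hn ⊢
    exact (h.eq_iff i j).1 hn
  | succ n ih =>
    rw [SimpleGraph.Walk.exists_length_eq_succ_iff] at hn ⊢
    obtain ⟨x, ha, hx⟩ := hn
    -- The second vertex of the walk goes into the spare entry `l`; the rest of the walk then joins
    -- entries `l` and `j` of a new equivalent pair.
    obtain ⟨l, -, hi, hj⟩ := exists_fin_four_ne i j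
    obtain ⟨σ, hσ⟩ := h.exists_equiv l
    refine ⟨σ x, ?_, ?_⟩
    · simpa [hi.symm] using ((hσ x).adj_iff i l).1 (by simpa [hi.symm] using ha)
    · have := ih (hσ x) (i := l)
      rw [Function.update_self, Function.update_self, Function.update_of_ne hj.symm,
        Function.update_of_ne hj.symm] at this
      exact this hx

theorem exists_walk_length_iff (h : WLEquiv G H v v') (i j : Fin 4) (n : ℕ) :
    (∃ p : G.Walk (v i) (v j), p.length = n) ↔ ∃ p : H.Walk (v' i) (v' j), p.length = n :=
  ⟨h.exists_walk_of_length n, h.symm.exists_walk_of_length n⟩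

theorem reachable_iff (h : WLEquiv G H v v') (i j : Fin 4) :
    G.Reachable (v i) (v j) ↔ H.Reachable (v' i) (v' j) :=
  ⟨fun ⟨p⟩ => ((h.exists_walk_length_iff i j _).1 ⟨p, rfl⟩).elim fun q _ => ⟨q⟩,
    fun ⟨p⟩ => ((h.exists_walk_length_iff i j _).2 ⟨p, rfl⟩).elim fun q _ => ⟨q⟩⟩

/-- The sets of walk lengths coincide, hence so do their infima; this includes the default value 0
for unreachable pairs. -/
theorem dist_eq (h : WLEquiv G H v v') (i j : Fin 4) :
    G.dist (v i) (v j) = H.dist (v' i) (v' j) := by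
  rw [SimpleGraph.dist_eq_sInf, SimpleGraph.dist_eq_sInf]
  congr 1
  ext n
  exact h.exists_walk_length_iff i j n

theorem mem_vicinity_iff (h : WLEquiv G H v v') (i j : Fin 4) (k : ℕ∞) :
    v j ∈ vicinity G k (v i) ↔ v' j ∈ vicinity H k (v' i) := by
  simp only [vicinity, Set.mem_ofPred_eq, h.reachable_iff i j, h.dist_eq i j]

end WLEquiv

/-! ### Matching sets and graphs that are defined from a root vertex -/

variable (G H) in
/-- Colour-equivalent `4`-tuples whose entries at `0` are prescribed roots. -/
structure RootedWLEquiv (w : V) (w' : W) (v : Fin 4 → V) (v' : Fin 4 → W) : Prop where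
  equiv : WLEquiv G H v v'
  root : v 0 = w
  root' : v' 0 = w'

variable (G H) in
/-- Sets of vertices that contain corresponding entries of equivalent tuples. -/
def SetsMatch (w : V) (w' : W) (A : Set V) (A' : Set W) : Prop :=
  ∀ v v', RootedWLEquiv G H w w' v v' → ∀ i, v i ∈ A ↔ v' i ∈ A'

variable (G H) in
/-- Graphs in which corresponding entries of equivalent tuples are adjacent. -/
def GraphsMatch (w : V) (w' : W) (K : SimpleGraph V) (K' : SimpleGraph W) : Prop :=
  ∀ v v', RootedWLEquiv G H w w' v v' → ∀ i j, K.Adj (v i) (v j) ↔ K'.Adj (v' i) (v' j)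

variable {w : V} {w' : W} {v : Fin 4 → V} {v' : Fin 4 → W} {A : Set V} {A' : Set W}
  {K K₁ K₂ : SimpleGraph V} {K' K₁' K₂' : SimpleGraph W}

namespace RootedWLEquiv

theorem symm (h : RootedWLEquiv G H w w' v v') : RootedWLEquiv H G w' w v' v :=
  ⟨h.equiv.symm, h.root', h.root⟩

theorem const (h : WLEquiv G H (fun _ : Fin 4 => w) (fun _ => w')) :
    RootedWLEquiv G H w w' (fun _ => w) (fun _ => w') :=
  ⟨h, rfl, rfl⟩

theorem exists_equiv (h : RootedWLEquiv G H w w' v v') {i : Fin 4} (hi : i ≠ 0) :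
    ∃ σ : V ≃ W, ∀ x,
      RootedWLEquiv G H w w' (Function.update v i x) (Function.update v' i (σ x)) := by
  obtain ⟨σ, hσ⟩ := h.equiv.exists_equiv i
  exact ⟨σ, fun x => ⟨hσ x, by simp [hi.symm, h.root], by simp [hi.symm, h.root']⟩⟩

end RootedWLEquiv

theorem GraphsMatch.symm (h : GraphsMatch G H w w' K K') : GraphsMatch H G w' w K' K :=
  fun _ _ hv i j => (h _ _ hv.symm i j).symm

theorem GraphsMatch.inf (h₁ : GraphsMatch G H w w' K₁ K₁') (h₂ : GraphsMatch G H w w' K₂ K₂') :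
    GraphsMatch G H w w' (K₁ ⊓ K₂) (K₁' ⊓ K₂') :=
  fun _ _ hv i j => and_congr (h₁ _ _ hv i j) (h₂ _ _ hv i j)

/-- Induction on the last step of a path: its penultimate vertex is placed in the spare entry. That
entry must not be 0, because adjacency in `K` is matched only while the root stays in place. -/
theorem GraphsMatch.reachable_of_reachable (h : GraphsMatch G H w w' K K')
    (hv : RootedWLEquiv G H w w' v v') {i j : Fin 4} (hr : K.Reachable (v i) (v j)) :
    K'.Reachable (v' i) (v' j) := by
  generalize ha : v i = a at hr
  generalize hb : v j = b at hr
  rw [SimpleGraph.reachable_iff_reflTransGen] at hr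
  induction hr generalizing v v' j with
  | refl => rw [(hv.equiv.eq_iff i j).1 (ha.trans hb.symm)]
  | @tail b c _ hbc ih =>
    obtain ⟨l, hl, hi, hj⟩ := exists_fin_four_ne i j
    obtain ⟨σ, hσ⟩ := hv.exists_equiv hl
    have h₁ : K'.Reachable (v' i) (σ b) := by
      simpa [hi.symm] using ih (hσ b) (j := l) (by simpa [hi.symm] using ha) (by simp)
    have h₂ : K'.Adj (σ b) (v' j) := by
      simpa [hj.symm] using (h _ _ (hσ b) l j).1 (by simpa [hj.symm, hb] using hbc)
    exact h₁.trans h₂.reachable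

theorem GraphsMatch.reachable_iff (h : GraphsMatch G H w w' K K')
    (hv : RootedWLEquiv G H w w' v v') (i j : Fin 4) :
    K.Reachable (v i) (v j) ↔ K'.Reachable (v' i) (v' j) :=
  ⟨h.reachable_of_reachable hv, h.symm.reachable_of_reachable hv.symm⟩

end WLEquiv

namespace GraphHomology

variable {V : Type*} {G : SimpleGraph V}

/-! ### The dimension of a space of relative cycles -/

section Dimension

variable [Fintype V]

theorem boundary_apply (c : Sym2 V → ZMod 2) (v : V) :
    boundary G c v = ∑ e, (G.incidenceSet v).indicator c e := by
  classical
  simp only [boundary, Matrix.mulVecLin_apply, Matrix.mulVec, dotProduct,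
    SimpleGraph.incMatrix_apply, Set.indicator]
  exact Finset.sum_congr rfl fun e _ => by split_ifs <;> simp

variable (G) in
/-- The `1`-chains that are supported on the edges of `K` and whose boundary is supported on `A`. -/
noncomputable def cyclesRel (K : SimpleGraph V) (A : Set V) :
    Submodule (ZMod 2) (Sym2 V → ZMod 2) where
  carrier := {c | (∀ e, e ∉ K.edgeSet → c e = 0) ∧ ∀ v, v ∉ A → boundary G c v = 0}
  zero_mem' := ⟨fun _ _ => rfl, fun _ _ => by simp⟩
  add_mem' := fun ha hb =>
    ⟨fun e he => by simp [ha.1 e he, hb.1 e he], fun v hv => by simp [ha.2 v hv, hb.2 v hv]⟩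
  smul_mem' := fun r c hc =>
    ⟨fun e he => by simp [hc.1 e he], fun v hv => by simp [hc.2 v hv]⟩

theorem mem_cyclesRel {K : SimpleGraph V} {A : Set V} {c : Sym2 V → ZMod 2} :
    c ∈ cyclesRel G K A ↔
      (∀ e, e ∉ K.edgeSet → c e = 0) ∧ ∀ v, v ∉ A → boundary G c v = 0 := Iff.rfl

open Classical in
/-- The incidence matrix of `K` with the rows in `A` deleted. -/
noncomputable def incidenceOutside (K : SimpleGraph V) (A : Set V) :
    Matrix {v // v ∉ A} K.edgeSet (ZMod 2) :=
  fun v e => if (v : V) ∈ (e : Sym2 V) then 1 else 0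

/-- The connected components of `K` that do not meet `A`. -/
abbrev ComponentsAvoiding (K : SimpleGraph V) (A : Set V) : Type _ :=
  {C : K.ConnectedComponent // ∀ u ∈ A, K.connectedComponentMk u ≠ C}

variable {K : SimpleGraph V} {A : Set V}

/-- Restricting chains to the edges of `K` is injective on this space, and on chains supported there
the boundary in `G` is given by the incidences of `K`. -/
theorem finrank_cyclesRel_eq_finrank_ker [Fintype K.edgeSet] (hK : K ≤ G) :
    Module.finrank (ZMod 2) (cyclesRel G K A) =
      Module.finrank (ZMod 2) (LinearMap.ker (incidenceOutside K A).mulVecLin) := by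
  classical
  have key (c : Sym2 V → ZMod 2) (hc : ∀ e, e ∉ K.edgeSet → c e = 0) (v : {v // v ∉ A}) :
      (incidenceOutside K A).mulVec (fun e => c e) v = boundary G c v := by
    rw [boundary_apply]
    simp only [Matrix.mulVec, dotProduct, incidenceOutside, ite_mul, one_mul, zero_mul]
    rw [← Finset.sum_subtype (Finset.univ.filter (· ∈ K.edgeSet)) (by simp)
      (fun e => if (v : V) ∈ e then c e else 0), Finset.sum_filter]
    refine Finset.sum_congr rfl fun e _ => ?_
    by_cases he : e ∈ K.edgeSet
    · simp [he, Set.indicator, SimpleGraph.incidenceSet, SimpleGraph.edgeSet_mono hK he]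
    · simp [he, Set.indicator, hc e he]
  let f : cyclesRel G K A →ₗ[ZMod 2] (K.edgeSet → ZMod 2) :=
    (LinearMap.funLeft (ZMod 2) (ZMod 2) Subtype.val).comp (cyclesRel G K A).subtype
  have hf : Function.Injective f := by
    intro c d hcd
    ext e
    by_cases he : e ∈ K.edgeSet
    · exact congrFun hcd ⟨e, he⟩
    · rw [c.2.1 e he, d.2.1 e he]
  suffices hker : LinearMap.range f = LinearMap.ker (incidenceOutside K A).mulVecLin by
    rw [← hker, LinearMap.finrank_range_of_inj hf]
  ext x
  rw [LinearMap.mem_range, LinearMap.mem_ker, Matrix.mulVecLin_apply]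
  constructor
  · rintro ⟨c, rfl⟩
    funext v
    exact (key c c.2.1 v).trans (c.2.2 v v.2)
  · intro hx
    have hc (e) (he : e ∉ K.edgeSet) :
        (fun e => if h : e ∈ K.edgeSet then x ⟨e, h⟩ else 0) e = 0 := by simp [he]
    have hcx : (fun e : K.edgeSet => if h : (e : Sym2 V) ∈ K.edgeSet then x ⟨e, h⟩ else 0) = x := by
      ext e; simp
    refine ⟨⟨_, hc, fun v hv => ?_⟩, hcx⟩
    rw [← key _ hc ⟨v, hv⟩, hcx, hx]
    rfl

/-- A kernel vector, extended by zero to `A`, has equal values at the ends of each edge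
(characteristic 2). It is thus constant on components and zero on those meeting `A`, with free
values on the others. -/
theorem finrank_ker_transpose [Fintype {v // v ∉ A}] :
    Module.finrank (ZMod 2) (LinearMap.ker (incidenceOutside K A).transpose.mulVecLin) =
      Nat.card (ComponentsAvoiding K A) := by
  classical
  have := Fintype.ofFinite (ComponentsAvoiding K A)
  -- the extension by zero of a function on the complement of `A`
  let ext₀ (x : {v // v ∉ A} → ZMod 2) (v : V) : ZMod 2 := if h : v ∉ A then x ⟨v, h⟩ else 0
  have key (x : {v // v ∉ A} → ZMod 2) (a b : V) (hab : K.Adj a b) :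
      (incidenceOutside K A).transpose.mulVec x ⟨s(a, b), hab⟩ = ext₀ x a + ext₀ x b := by
    simp only [Matrix.mulVec, dotProduct, incidenceOutside, Matrix.transpose_apply, ite_mul,
      one_mul, zero_mul]
    have h₁ : ∀ v : {v // v ∉ A}, (if (v : V) ∈ s(a, b) then x v else 0) =
        (fun v : V => if v ∈ s(a, b) then ext₀ x v else 0) v := fun v => by
      simp [ext₀, v.2]
    rw [Finset.sum_congr rfl fun v _ => h₁ v,
      ← Finset.sum_subtype (Finset.univ.filter (· ∉ A)) (by simp)
        (fun v : V => if v ∈ s(a, b) then ext₀ x v else 0), Finset.sum_filter]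
    rw [← Finset.sum_pair hab.ne, ← Finset.sum_filter, ← Finset.sum_filter]
    -- An endpoint missing from the smaller sum lies in `A`, where `ext₀ x` is zero.
    refine (Finset.sum_subset ?_ ?_)
    · intro v hv
      simpa using (Finset.mem_filter.1 hv).2
    · intro v hv hv'
      have : v ∈ A := by
        by_contra hA
        simp [hA] at hv'
        simp at hv
        tauto
      simp [ext₀, this]
  let F (g : ComponentsAvoiding K A → ZMod 2) (C : K.ConnectedComponent) : ZMod 2 :=
    if h : ∀ u ∈ A, K.connectedComponentMk u ≠ C then g ⟨C, h⟩ else 0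
  let f : (ComponentsAvoiding K A → ZMod 2) →ₗ[ZMod 2] ({v // v ∉ A} → ZMod 2) :=
    { toFun := fun g v => F g (K.connectedComponentMk v)
      map_add' := fun g g' => by ext v; dsimp only [F, Pi.add_apply]; split_ifs <;> simp
      map_smul' := fun r g => by ext v; dsimp only [F, Pi.smul_apply]; split_ifs <;> simp }
  have hf : Function.Injective f := by
    intro g g' hg
    funext ⟨C, hC⟩
    induction C using SimpleGraph.ConnectedComponent.ind with | _ v =>
    have := congrFun hg ⟨v, fun hv => hC v hv rfl⟩
    simpa only [f, F, LinearMap.coe_mk, AddHom.coe_mk, dif_pos hC] using this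
  have hext (g : ComponentsAvoiding K A → ZMod 2) (v : V) :
      ext₀ (f g) v = F g (K.connectedComponentMk v) := by
    by_cases hv : v ∈ A
    · have : ¬ ∀ u ∈ A, K.connectedComponentMk u ≠ K.connectedComponentMk v :=
        fun h => h v hv rfl
      simp only [ext₀, F, dif_neg this, dif_neg (not_not.2 hv)]
    · simp only [ext₀, dif_pos hv]
      rfl
  suffices hker : LinearMap.range f =
      LinearMap.ker (incidenceOutside K A).transpose.mulVecLin by
    rw [← hker, LinearMap.finrank_range_of_inj hf, Module.finrank_fintype_fun_eq_card,
      Nat.card_eq_fintype_card]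
  ext x
  rw [LinearMap.mem_range, LinearMap.mem_ker, Matrix.mulVecLin_apply]
  constructor
  · rintro ⟨g, rfl⟩
    funext ⟨e, he⟩
    induction e with | _ a b =>
    have hab : K.Adj a b := he
    rw [key _ a b hab, hext, hext, SimpleGraph.ConnectedComponent.sound hab.reachable]
    exact CharTwo.add_self_eq_zero _
  · intro hx
    have hadj {a b : V} (hab : K.Adj a b) : ext₀ x a = ext₀ x b := by
      have := key x a b hab
      rw [hx] at this
      exact CharTwo.add_eq_zero.1 this.symm
    have hreach {a b : V} (hab : K.Reachable a b) : ext₀ x a = ext₀ x b := by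
      rw [SimpleGraph.reachable_iff_reflTransGen] at hab
      induction hab with
      | refl => rfl
      | tail _ h ih => exact ih.trans (hadj h)
    refine ⟨fun C => ext₀ x C.1.out, funext fun v => ?_⟩
    have hv : ext₀ x v = x v := by simp only [ext₀, dif_pos v.2]
    rw [← hv]
    change F (fun C => ext₀ x C.1.out) (K.connectedComponentMk v) = _
    by_cases h : ∀ u ∈ A, K.connectedComponentMk u ≠ K.connectedComponentMk v
    · simp only [F, dif_pos h]
      exact hreach (SimpleGraph.ConnectedComponent.exact (Quot.out_eq _))
    · simp only [F, dif_neg h]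
      push Not at h
      obtain ⟨u, hu, huv⟩ := h
      rw [← hreach (SimpleGraph.ConnectedComponent.exact huv)]
      simp only [ext₀, dif_neg (not_not.2 hu)]

/-- Rank-nullity for the incidence matrix and for its transpose, which have the same rank. -/
theorem finrank_cyclesRel (hK : K ≤ G) :
    Module.finrank (ZMod 2) (cyclesRel G K A) + Nat.card {v // v ∉ A} =
      Nat.card K.edgeSet + Nat.card (ComponentsAvoiding K A) := by
  classical
  have h₁ := LinearMap.finrank_range_add_finrank_ker (incidenceOutside K A).mulVecLin
  have h₂ := LinearMap.finrank_range_add_finrank_ker (incidenceOutside K A).transpose.mulVecLin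
  rw [finrank_ker_transpose] at h₂
  rw [← finrank_cyclesRel_eq_finrank_ker hK] at h₁
  have h₃ := Matrix.rank_transpose (incidenceOutside K A)
  simp only [Matrix.rank] at h₃
  rw [Module.finrank_fintype_fun_eq_card, ← Nat.card_eq_fintype_card] at h₁ h₂
  omega

end Dimension

end GraphHomology

open GraphHomology

/-! ### Edge and component counts as sums over vertices -/

theorem card_edgeSet_mul_two {V : Type*} [Fintype V] (K : SimpleGraph V) :
    2 * Nat.card K.edgeSet = ∑ x, Nat.card {y // K.Adj x y} := by
  classical
  have := K.sum_degrees_eq_twice_card_edges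
  rw [Nat.card_eq_fintype_card, ← SimpleGraph.edgeFinset_card, ← this]
  refine Finset.sum_congr rfl fun x _ => ?_
  rw [← SimpleGraph.card_neighborSet_eq_degree, ← Nat.card_eq_fintype_card]
  rfl

open Classical in
-- Each vertex of a component carries the weight 1/size, so a component contributes 1 in total. The
-- WL bijections act on vertices, not on components, and can match a sum of this form.
theorem card_componentsAvoiding {V : Type*} [Fintype V] (K : SimpleGraph V) (A : Set V) :
    (Nat.card (ComponentsAvoiding K A) : ℚ) =
      ∑ v : V, if ∀ u, K.Reachable v u → u ∉ A then (Nat.card {u // K.Reachable v u} : ℚ)⁻¹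
        else 0 := by
  have := Fintype.ofFinite K.ConnectedComponent
  rw [← Finset.sum_fiberwise Finset.univ K.connectedComponentMk, Nat.card_eq_fintype_card,
    Fintype.card_subtype, Finset.card_filter, Nat.cast_sum]
  refine Finset.sum_congr rfl fun C _ => ?_
  induction C using SimpleGraph.ConnectedComponent.ind with | _ x =>
  have h (v : V) (hv : v ∈ Finset.univ.filter
      fun v => K.connectedComponentMk v = K.connectedComponentMk x) :
      (if ∀ u, K.Reachable v u → u ∉ A then (Nat.card {u // K.Reachable v u} : ℚ)⁻¹ else 0) =
      if ∀ u, K.Reachable x u → u ∉ A then (Nat.card {u // K.Reachable x u} : ℚ)⁻¹ else 0 := by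
    have hvx : K.Reachable v x := SimpleGraph.ConnectedComponent.exact (Finset.mem_filter.1 hv).2
    have hiff (u : V) : K.Reachable v u ↔ K.Reachable x u := ⟨hvx.symm.trans, hvx.trans⟩
    simp only [hiff]
  have hcard : Nat.card {u // K.Reachable x u} = (Finset.univ.filter
      fun v => K.connectedComponentMk v = K.connectedComponentMk x).card := by
    rw [Nat.card_eq_fintype_card, Fintype.card_subtype]
    congr 1
    ext v
    simp [SimpleGraph.reachable_comm]
  have hpos : (Nat.card {u // K.Reachable x u} : ℚ) ≠ 0 := by
    have : Nonempty {u // K.Reachable x u} := ⟨⟨x, .refl x⟩⟩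
    exact_mod_cast Nat.card_pos.ne'
  have hP : (∀ u ∈ A, K.connectedComponentMk u ≠ K.connectedComponentMk x) ↔
      ∀ u, K.Reachable x u → u ∉ A := by
    simp only [ne_eq, SimpleGraph.ConnectedComponent.eq, SimpleGraph.reachable_comm (v := x)]
    exact ⟨fun h u hr hu => h u hu hr, fun h u hu hr => h u hr hu⟩
  rw [Finset.sum_congr rfl h, Finset.sum_const, ← hcard, nsmul_eq_mul]
  simp only [hP]
  split_ifs
  · rw [mul_inv_cancel₀ hpos, Nat.cast_one]
  · simp

section Match

variable {V W : Type*} [Fintype V] [Fintype W] {G : SimpleGraph V} {H : SimpleGraph W}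
  {w : V} {w' : W} {A : Set V} {A' : Set W} {K : SimpleGraph V} {K' : SimpleGraph W}

/-- Two moves of the game: x enters position 1, then y enters position 2. The second bijection
depends on x, which suffices for sums over x of counts over y. -/
theorem exists_equiv_of_match (h : WLEquiv G H (fun _ : Fin 4 => w) (fun _ => w'))
    (hK : GraphsMatch G H w w' K K') (hA : SetsMatch G H w w' A A') :
    ∃ σ : V ≃ W, (∀ x, x ∈ A ↔ σ x ∈ A') ∧ ∀ x, ∃ τ : V ≃ W, ∀ y,
      (y ∈ A ↔ τ y ∈ A') ∧ (K.Adj x y ↔ K'.Adj (σ x) (τ y)) ∧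
        (K.Reachable x y ↔ K'.Reachable (σ x) (τ y)) := by
  obtain ⟨σ, hσ⟩ := (RootedWLEquiv.const h).exists_equiv (i := 1) (by decide)
  refine ⟨σ, fun x => by simpa using hA _ _ (hσ x) 1, fun x => ?_⟩
  obtain ⟨τ, hτ⟩ := (hσ x).exists_equiv (i := 2) (by decide)
  exact ⟨τ, fun y => ⟨by simpa using hA _ _ (hτ y) 2, by simpa using hK _ _ (hτ y) 1 2,
    by simpa using hK.reachable_iff (hτ y) 1 2⟩⟩

/-- The dimension of a space of relative cycles is determined by the colour of the root. -/
theorem finrank_cyclesRel_eq_of_match (h : WLEquiv G H (fun _ : Fin 4 => w) (fun _ => w'))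
    (hK : GraphsMatch G H w w' K K') (hA : SetsMatch G H w w' A A') (hKG : K ≤ G)
    (hKH : K' ≤ H) :
    Module.finrank (ZMod 2) (cyclesRel G K A) = Module.finrank (ZMod 2) (cyclesRel H K' A') := by
  classical
  obtain ⟨σ, hσ, hτ⟩ := exists_equiv_of_match h hK hA
  have hverts : Nat.card {v // v ∉ A} = Nat.card {v // v ∉ A'} :=
    Nat.card_congr (σ.subtypeEquiv fun x => not_congr (hσ x))
  have hedges : 2 * Nat.card K.edgeSet = 2 * Nat.card K'.edgeSet := by
    rw [card_edgeSet_mul_two, card_edgeSet_mul_two]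
    refine Fintype.sum_equiv σ _ _ fun x => ?_
    obtain ⟨τ, hτ⟩ := hτ x
    exact Nat.card_congr (τ.subtypeEquiv fun y => (hτ y).2.1)
  have hcomp : (Nat.card (ComponentsAvoiding K A) : ℚ) = Nat.card (ComponentsAvoiding K' A') := by
    rw [card_componentsAvoiding, card_componentsAvoiding]
    refine Fintype.sum_equiv σ _ _ fun x => ?_
    obtain ⟨τ, hτ⟩ := hτ x
    have hcard : Nat.card {u // K.Reachable x u} = Nat.card {u // K'.Reachable (σ x) u} :=
      Nat.card_congr (τ.subtypeEquiv fun y => (hτ y).2.2)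
    have hav : (∀ u, K.Reachable x u → u ∉ A) ↔ ∀ u, K'.Reachable (σ x) u → u ∉ A' :=
      τ.forall_congr fun {y} => by rw [(hτ y).1, (hτ y).2.2]
    simp only [hcard, hav]
  have h₁ := finrank_cyclesRel (A := A) hKG
  have h₂ := finrank_cyclesRel (A := A') hKH
  have h₃ : Nat.card (ComponentsAvoiding K A) = Nat.card (ComponentsAvoiding K' A') := by
    exact_mod_cast hcomp
  omega

end Match

/-! ### Ranks of the maps between relative homology groups -/

namespace GraphHomology

variable {V : Type*} [Fintype V] {G : SimpleGraph V} {P Q : G.Subgraph × G.Subgraph}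

theorem relCycles_eq_cyclesRel :
    relCycles P = cyclesRel G P.1.spanningCoe P.2.verts := by
  ext c
  rw [mem_cyclesRel, SimpleGraph.Subgraph.edgeSet_spanningCoe]
  exact Iff.rfl

/-- Intersecting with the chains of `L` only shrinks the allowed edges; the boundary condition is
still that of `P.2`. The one dimension formula therefore covers this space too. -/
theorem relCycles_inf_chains₁_eq_cyclesRel (L : G.Subgraph) :
    relCycles P ⊓ chains₁ L = cyclesRel G (P.1.spanningCoe ⊓ L.spanningCoe) P.2.verts := by
  ext c
  rw [relCycles_eq_cyclesRel, Submodule.mem_inf, mem_cyclesRel, mem_cyclesRel,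
    SimpleGraph.edgeSet_inf, SimpleGraph.Subgraph.edgeSet_spanningCoe,
    SimpleGraph.Subgraph.edgeSet_spanningCoe]
  constructor
  · rintro ⟨⟨h₁, h₂⟩, h₃⟩
    exact ⟨fun e he => (not_and_or.1 he).elim (h₁ e) (h₃ e), h₂⟩
  · rintro ⟨h₁, h₂⟩
    exact ⟨⟨fun e he => h₁ e fun h => he h.1, h₂⟩, fun e he => h₁ e fun h => he h.2⟩

/-- Since `H₁ P` is a quotient of the cycles, the rank can be computed on `relCycles P`, where the
kernel consists of the cycles that are chains of `Q.2`. -/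
theorem rank₁_add_finrank (h : P ≤ Q) :
    rank₁ h + Module.finrank (ZMod 2) ↥(relCycles P ⊓ chains₁ Q.2) =
      Module.finrank (ZMod 2) (relCycles P) := by
  let g : relCycles P →ₗ[ZMod 2] H₁ Q :=
    ((chains₁ Q.2).submoduleOf (relCycles Q)).mkQ.comp
      (Submodule.inclusion (relCycles_mono h))
  have hrange : LinearMap.range g = LinearMap.range (H₁map h) := by
    have : g = (H₁map h).comp ((chains₁ P.2).submoduleOf (relCycles P)).mkQ := rfl
    rw [this, LinearMap.range_comp, Submodule.range_mkQ, LinearMap.range_eq_map]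
  have hker : LinearMap.ker g = (relCycles P ⊓ chains₁ Q.2).submoduleOf (relCycles P) := by
    ext c
    simp only [g, LinearMap.ker_comp, Submodule.ker_mkQ, Submodule.mem_comap]
    exact ⟨fun hc => ⟨c.2, hc⟩, fun hc => hc.2⟩
  have := LinearMap.finrank_range_add_finrank_ker g
  rw [hrange, hker, (Submodule.submoduleOfEquivOfLe inf_le_left).finrank_eq] at this
  exact this

theorem rank₁_eq_zero (h : P ≤ Q) (hP : relCycles P ≤ chains₁ P.2) : rank₁ h = 0 := by
  have := rank₁_add_finrank h
  rw [inf_eq_left.2 (hP.trans (chains₁_mono h.2))] at this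
  omega

end GraphHomology

section SubgraphsMatch

variable {V W : Type*} [Fintype V] [Fintype W] {G : SimpleGraph V} {H : SimpleGraph W}
  {w : V} {w' : W}

variable (w w') in
/-- Subgraphs whose vertices and edges match. -/
structure SubgraphsMatch (K : G.Subgraph) (K' : H.Subgraph) : Prop where
  verts : SetsMatch G H w w' K.verts K'.verts
  adj : GraphsMatch G H w w' K.spanningCoe K'.spanningCoe

variable (w w') in
/-- Pairs of subgraphs that match componentwise. -/
def PairsMatch (P : G.Subgraph × G.Subgraph) (P' : H.Subgraph × H.Subgraph) : Prop :=
  SubgraphsMatch w w' P.1 P'.1 ∧ SubgraphsMatch w w' P.2 P'.2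

theorem rank₁_eq_of_match {P Q : G.Subgraph × G.Subgraph} {P' Q' : H.Subgraph × H.Subgraph}
    (h : WLEquiv G H (fun _ : Fin 4 => w) (fun _ => w')) (hP : PairsMatch w w' P P')
    (hQ : PairsMatch w w' Q Q') (hPQ : P ≤ Q) (hPQ' : P' ≤ Q') : rank₁ hPQ = rank₁ hPQ' := by
  have h₁ := rank₁_add_finrank hPQ
  have h₂ := rank₁_add_finrank hPQ'
  rw [relCycles_inf_chains₁_eq_cyclesRel, relCycles_eq_cyclesRel] at h₁ h₂
  rw [finrank_cyclesRel_eq_of_match h hP.1.adj hP.2.verts (SimpleGraph.Subgraph.spanningCoe_le _)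
      (SimpleGraph.Subgraph.spanningCoe_le _),
    finrank_cyclesRel_eq_of_match h (hP.1.adj.inf hQ.2.adj) hP.2.verts
      (inf_le_left.trans (SimpleGraph.Subgraph.spanningCoe_le _))
      (inf_le_left.trans (SimpleGraph.Subgraph.spanningCoe_le _))] at h₁
  omega

end SubgraphsMatch

/-! ### The diagrams of equivalent roots -/

namespace ExtPersistence

variable {V W : Type*} [Fintype V] [Fintype W] {G : SimpleGraph V} {H : SimpleGraph W}
  {w : V} {w' : W} {S : Set V} {S' : Set W} {f : V → ℝ} {f' : W → ℝ} {κ : FiltrationKind}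

variable (w w' f f') (G H) in
/-- Filter functions that agree on corresponding entries of equivalent tuples. -/
def FiltersMatch : Prop :=
  ∀ v v', RootedWLEquiv G H w w' v v' → ∀ i, f (v i) = f' (v' i)

theorem subgraphsMatch_bot : SubgraphsMatch w w' (⊥ : G.Subgraph) (⊥ : H.Subgraph) :=
  ⟨fun _ _ _ _ => Iff.rfl, fun _ _ _ _ _ => Iff.rfl⟩

theorem subgraphsMatch_whole (hS : SetsMatch G H w w' S S') :
    SubgraphsMatch w w' (whole G S) (whole H S') :=
  ⟨hS, fun v v' hv i j =>
    and_congr (hS v v' hv i) (and_congr (hS v v' hv j) (hv.equiv.adj_iff i j))⟩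

/-- The value of an edge is a function of the filter values of its two endpoints; nothing else about
`κ` is needed, so both extensions are treated at once. -/
theorem subgraphsMatch_sublevel (hS : SetsMatch G H w w' S S')
    (hf : FiltersMatch G H w w' f f') (I : LowerSet ℝ) :
    SubgraphsMatch w w' (sublevel G S f κ I) (sublevel H S' f' κ I) where
  verts v v' hv i := and_congr (hS v v' hv i) (by rw [hf v v' hv i])
  adj v v' hv i j := and_congr (hv.equiv.adj_iff i j) (and_congr (hS v v' hv i)
    (and_congr (hS v v' hv j) (by rw [hf v v' hv i, hf v v' hv j])))

theorem subgraphsMatch_superlevel (hS : SetsMatch G H w w' S S')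
    (hf : FiltersMatch G H w w' f f') (I : UpperSet ℝ) :
    SubgraphsMatch w w' (superlevel G S f κ I) (superlevel H S' f' κ I) where
  verts v v' hv i := and_congr (hS v v' hv i) (by rw [hf v v' hv i])
  adj v v' hv i j := and_congr (hv.equiv.adj_iff i j) (and_congr (hS v v' hv i)
    (and_congr (hS v v' hv j) (by rw [hf v v' hv i, hf v v' hv j])))

theorem pairsMatch_pairAt (hS : SetsMatch G H w w' S S') (hf : FiltersMatch G H w w' f f')
    (p : ExtIndex) : PairsMatch w w' (pairAt G S f κ p) (pairAt H S' f' κ p) := by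
  cases p with
  | asc a => exact ⟨subgraphsMatch_sublevel hS hf _, subgraphsMatch_bot⟩
  | desc a => exact ⟨subgraphsMatch_whole hS, subgraphsMatch_superlevel hS hf _⟩

theorem pairsMatch_pairBefore (hS : SetsMatch G H w w' S S') (hf : FiltersMatch G H w w' f f')
    (p : ExtIndex) : PairsMatch w w' (pairBefore G S f κ p) (pairBefore H S' f' κ p) := by
  cases p with
  | asc a => exact ⟨subgraphsMatch_sublevel hS hf _, subgraphsMatch_bot⟩
  | desc a => exact ⟨subgraphsMatch_whole hS, subgraphsMatch_superlevel hS hf _⟩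

theorem diagram₁_eq_of_match (h : WLEquiv G H (fun _ : Fin 4 => w) (fun _ => w'))
    (hS : SetsMatch G H w w' S S') (hf : FiltersMatch G H w w' f f') :
    diagram₁ G S f κ = diagram₁ H S' f' κ := by
  funext p q
  unfold diagram₁
  split_ifs with hpq
  · have hp := pairsMatch_pairAt (κ := κ) hS hf p
    have hq := pairsMatch_pairAt (κ := κ) hS hf q
    have hp' := pairsMatch_pairBefore (κ := κ) hS hf p
    have hq' := pairsMatch_pairBefore (κ := κ) hS hf q
    dsimp only
    rw [rank₁_eq_of_match h hp hq', rank₁_eq_of_match h hp hq, rank₁_eq_of_match h hp' hq',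
      rank₁_eq_of_match h hp' hq]
  · rfl

end ExtPersistence

theorem distanceDiagram₁_eq_of_wlEquiv {V W : Type*} [Fintype V] [Fintype W]
    {G : SimpleGraph V} {H : SimpleGraph W} {w : V} {w' : W} (κ : FiltrationKind) (k : ℕ∞)
    (h : WLEquiv G H (fun _ : Fin 4 => w) (fun _ => w')) :
    distanceDiagram₁ κ k G w = distanceDiagram₁ κ k H w' := by
  refine ExtPersistence.diagram₁_eq_of_match h (fun v v' hv i => ?_) (fun v v' hv i => ?_)
  · rw [← hv.root, ← hv.root']
    exact hv.equiv.mem_vicinity_iff 0 i k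
  · rw [← hv.root, ← hv.root']
    exact congrArg Nat.cast (hv.equiv.dist_eq 0 i)

theorem WLDistinguishes_of_EPDDistinguishes {V W : Type*} [Fintype V] [Fintype W]
    {G : SimpleGraph V} {H : SimpleGraph W} {κ : FiltrationKind} {k : ℕ∞}
    (h : EPDDistinguishes κ k G H) : WLDistinguishes 4 G H := by
  by_contra hWL
  obtain ⟨σ, hσ⟩ := exists_equiv_const_of_not_WLDistinguishes hWL
  exact h (map_univ_eq_of_equiv σ fun x => distanceDiagram₁_eq_of_wlEquiv κ k (hσ x))

/-! ### Two graphs with empty diagrams that differ in their edges -/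

namespace ExtPersistence

/-- The hypotheses make the source group of each of the four maps vanish. -/
theorem diagram₁_eq_zero {V : Type*} [Fintype V] {G : SimpleGraph V} {S : Set V} {f : V → ℝ}
    {κ : FiltrationKind} (hbot : ∀ K : G.Subgraph, relCycles (K, ⊥) ≤ chains₁ (⊥ : G.Subgraph))
    (hsup : ∀ I, relCycles (whole G S, superlevel G S f κ I) ≤ chains₁ (superlevel G S f κ I)) :
    diagram₁ G S f κ = 0 := by
  have hAt (p : ExtIndex) : relCycles (pairAt G S f κ p) ≤ chains₁ (pairAt G S f κ p).2 := by
    cases p with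
    | asc a => exact hbot _
    | desc a => exact hsup _
  have hBefore (p : ExtIndex) :
      relCycles (pairBefore G S f κ p) ≤ chains₁ (pairBefore G S f κ p).2 := by
    cases p with
    | asc a => exact hbot _
    | desc a => exact hsup _
  funext p q
  unfold diagram₁
  split_ifs with hpq
  · simp [rank₁_eq_zero _ (hAt p), rank₁_eq_zero _ (hBefore p)]
  · rfl

end ExtPersistence

theorem distanceDiagram₁_bot {V : Type*} [Fintype V] (κ : FiltrationKind) (k : ℕ∞) (w : V) :
    distanceDiagram₁ κ k (⊥ : SimpleGraph V) w = 0 := by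
  have h (P : (⊥ : SimpleGraph V).Subgraph × (⊥ : SimpleGraph V).Subgraph) :
      relCycles P ≤ chains₁ P.2 := fun c hc e _ =>
    hc.1 e fun he => by simpa using P.1.edgeSet_subset he
  exact ExtPersistence.diagram₁_eq_zero (fun K => h (K, ⊥)) fun I => h _

theorem Sym2.eq_of_mem_edgeSet_top_fin_two {e : Sym2 (Fin 2)}
    (he : e ∈ (⊤ : SimpleGraph (Fin 2)).edgeSet) : e = s(0, 1) := by
  induction e with | _ a b =>
  rw [SimpleGraph.mem_edgeSet, SimpleGraph.top_adj] at he
  revert a b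
  decide

/-- A single edge has no relative `1`-cycles beyond the chains of the subgraph, unless the
subgraph consists of the two endpoints alone. -/
theorem relCycles_le_chains₁_of_fin_two {P : (⊤ : SimpleGraph (Fin 2)).Subgraph ×
    (⊤ : SimpleGraph (Fin 2)).Subgraph} (hP : 0 ∈ P.2.verts → 1 ∈ P.2.verts → P.2.Adj 0 1) :
    relCycles P ≤ chains₁ P.2 := by
  intro c hc e he
  by_contra hce
  have he₁ : e ∈ P.1.edgeSet := by
    by_contra h
    exact hce (hc.1 e h)
  obtain rfl := Sym2.eq_of_mem_edgeSet_top_fin_two (P.1.edgeSet_subset he₁)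
  -- The only edge meets both vertices, so a nonzero coefficient forces both of them into `P.2`.
  have hb (v : Fin 2) : boundary ⊤ c v = c s(0, 1) := by
    rw [boundary_apply, Finset.sum_eq_single s(0, 1)]
    · have hv : v ∈ s((0 : Fin 2), 1) := by revert v; decide
      have hmem : s((0 : Fin 2), 1) ∈ (⊤ : SimpleGraph (Fin 2)).incidenceSet v := ⟨by simp, hv⟩
      exact Set.indicator_of_mem hmem c
    · intro e _ hne
      exact Set.indicator_of_notMem (fun h => hne (Sym2.eq_of_mem_edgeSet_top_fin_two h.1)) c
    · simp
  have hv (v : Fin 2) : v ∈ P.2.verts := by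
    by_contra h
    exact hce ((hb v).symm.trans (hc.2 v h))
  exact he (hP (hv 0) (hv 1))

/-- The two distances to the root are 0 and 1, so the half-shift never applies and the edge enters
the superlevel subgraph together with its lower endpoint. The exceptional pair with both endpoints
but no edge does not occur. -/
theorem distanceDiagram₁_top_fin_two (κ : FiltrationKind) (k : ℕ∞) (w : Fin 2) :
    distanceDiagram₁ κ k (⊤ : SimpleGraph (Fin 2)) w = 0 := by
  refine ExtPersistence.diagram₁_eq_zero
    (fun K => relCycles_le_chains₁_of_fin_two fun h => h.elim) fun I =>
    relCycles_le_chains₁_of_fin_two fun h₀ h₁ => ⟨by simp, h₀.1, h₁.1, ?_⟩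
  have hne : ((⊤ : SimpleGraph (Fin 2)).dist w 0 : ℝ) ≠ (⊤ : SimpleGraph (Fin 2)).dist w 1 := by
    fin_cases w <;> simp [SimpleGraph.dist_top]
  have hdesc {x y : ℝ} (hxy : x ≠ y) : κ.desc x y = min x y := by
    cases κ
    · rfl
    · exact if_neg hxy
  rw [hdesc hne]
  rcases min_choice ((⊤ : SimpleGraph (Fin 2)).dist w 0 : ℝ)
    ((⊤ : SimpleGraph (Fin 2)).dist w 1) with h | h
  · rw [h]; exact h₀.2
  · rw [h]; exact h₁.2

theorem WLDistinguishes_top_bot_fin_two :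
    WLDistinguishes 4 (⊤ : SimpleGraph (Fin 2)) (⊥ : SimpleGraph (Fin 2)) := by
  by_contra h
  obtain ⟨σ, hσ⟩ := exists_equiv_of_not_WLDistinguishes h
  -- Entries 0 and 1 are adjacent, which no tuple of the edgeless graph can match.
  simpa using (hσ ![0, 1, 0, 0]).adj_iff 0 1

theorem theorem3 (κ : FiltrationKind) (k : ℕ∞) :
    (∀ (V : Type*) (W : Type*) [Fintype V] [Fintype W] (G : SimpleGraph V) (H : SimpleGraph W),
      EPDDistinguishes κ k G H → WLDistinguishes 4 G H) ∧
    ∃ (n : ℕ) (G H : SimpleGraph (Fin n)),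
      WLDistinguishes 4 G H ∧ ¬ EPDDistinguishes κ k G H := by
  refine ⟨fun V W _ _ G H => WLDistinguishes_of_EPDDistinguishes, 2, ⊤, ⊥,
    WLDistinguishes_top_bot_fin_two, fun h => h ?_⟩
  simp only [distanceDiagram₁_bot, distanceDiagram₁_top_fin_two]
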